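/- Let $n\ge 2$, let $e_n$ be the $n$-th standard unit vector of $\mathbb{R}^n$, and let $B_r(y)$ denote the open ball of radius $r$ centred at $y$. There exists a constant $\tau_n>0$ depending only on $n$ with the following property. Let $\Omega\subset\mathbb{R}^n$ be a bounded domain (open and connected) with $0\in\partial\Omega$, let $D:=\sup_{x\in\Omega}|x|$, and suppose that for some $\rho>0$ the ball $B_\rho(-\rho e_n)$ is an exterior ball at $0$, that is, $B_\rho(-\rho e_n)\subset\mathbb{R}^n\setminus\overline{\Omega}$. If $\rho\ge D/\tau_n$, then $$\int_\Omega |\nabla u|^2\,dx\;\ge\;\frac{n^2}{4}\int_\Omega\frac{u^2}{|x|^2}\,dx\qquad\text{for all } u\in C_c^\infty(\Omega).$$ If in addition $\Omega$ satisfies an interior ball condition at $0$, that is, there are $y\in\mathbb{R}^n$ and $r>0$ with $|y|=r$ and $B_r(y)\subset\Omega$, then the constant $n^2/4$ is sharp: it is the largest real number $c$ such that $\int_\Omega |\nabla u|^2\,dx\ge c\int_\Omega u^2/|x|^2\,dx$ for all $u\in C_c^\infty(\Omega)$. -/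

import Mathlib

open scoped ContDiff Gradient

noncomputable section

/-- Euclidean space `ℝⁿ`. -/
abbrev EucSp (n : ℕ) : Type := EuclideanSpace ℝ (Fin n)

/-- The unit vector `e_n` in the direction of the last coordinate. -/
def lastUnit (n : ℕ) (hn : 2 ≤ n) : EucSp n :=
  EuclideanSpace.single (⟨n - 1, by omega⟩ : Fin n) (1 : ℝ)

/-- A bounded domain: a bounded, open, connected (in particular nonempty) set. -/
def IsBoundedDomain {n : ℕ} (Ω : Set (EucSp n)) : Prop :=
  IsOpen Ω ∧ IsConnected Ω ∧ Bornology.IsBounded Ω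

/-- `B_ρ(-ρ e_n)` is an exterior ball of `Ω` at `0`. -/
def HasExteriorBall {n : ℕ} (hn : 2 ≤ n) (Ω : Set (EucSp n)) (ρ : ℝ) : Prop :=
  0 < ρ ∧ Metric.ball (-(ρ • lastUnit n hn)) ρ ⊆ (closure Ω)ᶜ

/-- Interior ball condition at `0`: some open ball of positive radius contained in `Ω`
has `0` on its bounding sphere. -/
def HasInteriorBall {n : ℕ} (Ω : Set (EucSp n)) : Prop :=
  ∃ (y : EucSp n) (r : ℝ), 0 < r ∧ ‖y‖ = r ∧ Metric.ball y r ⊆ Ω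

/-- `D = sup_{x ∈ Ω} |x|`. -/
def maxNorm {n : ℕ} (Ω : Set (EucSp n)) : ℝ :=
  sSup ((fun x : EucSp n => ‖x‖) '' Ω)

/-- `u ∈ C_c^∞(Ω)`. -/
def IsTestFunction {n : ℕ} (Ω : Set (EucSp n)) (u : EucSp n → ℝ) : Prop :=
  ContDiff ℝ ∞ u ∧ HasCompactSupport u ∧ tsupport u ⊆ Ω

/-- The Hardy inequality on `Ω` with constant `c`, singularity at `0`. -/
def HardyInequality {n : ℕ} (Ω : Set (EucSp n)) (c : ℝ) : Prop :=
  ∀ u : EucSp n → ℝ, IsTestFunction Ω u →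
    c * ∫ x in Ω, u x ^ 2 / ‖x‖ ^ 2 ≤ ∫ x in Ω, ‖∇ u x‖ ^ 2

end

/-!
Let `p = -ρ eₙ` be the centre of the exterior ball and `b = 2p` its far pole. The bipolar field
`F = ∇ log w`, with `w = ⟨x, x - b⟩ (|x| |x - b|)^(-n/2)`, satisfies the exact identity
`div F + |F|² = -(n²/4) |b|² / (|x|² |x - b|²)`, and `w` is positive outside the closed ball whose
diameter joins `0` and `b`. Near `0` the right-hand side is `-n²/4 |x|⁻²` up to an error of order
`|x|⁻¹ |b|⁻¹`, which damping `w` by a factor `e^(-δ|x|)` absorbs as soon as `|x|` is small compared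
with `ρ`. The inequality follows by completing the square in `∫ |∇u - u F|² ≥ 0`.

For sharpness, blowing up an interior ball at `0` carries a Hardy inequality on `Ω` over to a half
space `{⟨ν, x⟩ > 0}`. Testing it with `⟨ν, x⟩ ψ(log |x|)` gives
`c ∫ e^(nt) ψ² ≤ ∫ e^(nt) ψ'²` on `(0, ∞)`, and `ψ(t) = e^(-nt/2) θ(qt)` with `q → 0` forces
`c ≤ n²/4`.
-/

open MeasureTheory Set Filter Topology Module
open scoped RealInnerProductSpace

section Divergence

variable {E : Type*} [NormedAddCommGroup E] [InnerProductSpace ℝ E]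

/-- The divergence of a vector field, as the trace of its derivative. -/
noncomputable def divergence (F : E → E) (x : E) : ℝ :=
  LinearMap.trace ℝ E (fderiv ℝ F x)

lemma divergence_add {F G : E → E} {x : E} (hF : DifferentiableAt ℝ F x)
    (hG : DifferentiableAt ℝ G x) :
    divergence (fun y => F y + G y) x = divergence F x + divergence G x := by
  simp [divergence, fderiv_fun_add hF hG]

variable [FiniteDimensional ℝ E]

lemma divergence_smul {f : E → ℝ} {F : E → E} {x : E} (hf : DifferentiableAt ℝ f x)
    (hF : DifferentiableAt ℝ F x) :
    divergence (fun y => f y • F y) x = fderiv ℝ f x (F x) + f x * divergence F x := by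
  simp [divergence, fderiv_fun_smul hf hF, add_comm]

lemma divergence_smul_sub {f : E → ℝ} {x : E} (hf : DifferentiableAt ℝ f x) (a : E) :
    divergence (fun y => f y • (y - a)) x = fderiv ℝ f x (x - a) + finrank ℝ E * f x := by
  rw [divergence_smul hf (by fun_prop), mul_comm (finrank ℝ E : ℝ)]
  simp [divergence, fderiv_sub_const]

lemma divergence_smul_id {f : E → ℝ} {x : E} (hf : DifferentiableAt ℝ f x) :
    divergence (fun y => f y • y) x = fderiv ℝ f x x + finrank ℝ E * f x := by
  simpa using divergence_smul_sub hf 0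

lemma divergence_eq_sum_inner (F : E → E) (x : E) :
    divergence F x = ∑ i, ⟪stdOrthonormalBasis ℝ E i, fderiv ℝ F x (stdOrthonormalBasis ℝ E i)⟫ :=
  LinearMap.trace_eq_sum_inner _ (stdOrthonormalBasis ℝ E)

end Divergence

section CompactSupport

variable {E G : Type*} [NormedAddCommGroup E] [NormedSpace ℝ E] [NormedAddCommGroup G]
  [NormedSpace ℝ G]

lemma contDiff_smul_of_tsupport {k : WithTop ℕ∞} {u : E → ℝ} {F : E → G} (hu : ContDiff ℝ k u)
    (hF : ∀ x ∈ tsupport u, ContDiffAt ℝ k F x) : ContDiff ℝ k (fun x => u x • F x) := by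
  refine contDiff_iff_contDiffAt.2 fun x => ?_
  by_cases hx : x ∈ tsupport u
  · exact hu.contDiffAt.smul (hF x hx)
  · refine (contDiffAt_const (c := (0 : G))).congr_of_eventuallyEq ?_
    filter_upwards [notMem_tsupport_iff_eventuallyEq.1 hx] with y hy
    simp [hy]

variable [MeasurableSpace E] [BorelSpace E] {μ : Measure E}

lemma integrable_fderiv_apply [IsFiniteMeasureOnCompacts μ] {F : E → G} (hF : ContDiff ℝ 1 F)
    (hc : HasCompactSupport F) (v : E) : Integrable (fun x => fderiv ℝ F x v) μ :=
  ((hF.continuous_fderiv one_ne_zero).clm_apply continuous_const).integrable_of_hasCompactSupport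
    (hc.fderiv_apply (𝕜 := ℝ) v)

lemma integral_fderiv_apply_eq_zero [FiniteDimensional ℝ E] [μ.IsAddHaarMeasure] {F : E → G}
    (hF : ContDiff ℝ 1 F) (hc : HasCompactSupport F) (v : E) : ∫ x, fderiv ℝ F x v ∂μ = 0 := by
  simpa using integral_smul_fderiv_eq_neg_fderiv_smul_of_integrable (μ := μ)
    (f := fun _ => (1 : ℝ)) (g := F) (v := v) (by simp)
    (by simpa using integrable_fderiv_apply hF hc v)
    (by simpa using hF.continuous.integrable_of_hasCompactSupport hc)
    (fun x _ => differentiableAt_const _) (fun x _ => hF.differentiable one_ne_zero x)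

end CompactSupport

section VectorFieldMethod

variable {E : Type*} [NormedAddCommGroup E] [InnerProductSpace ℝ E] [FiniteDimensional ℝ E]

lemma norm_gradient (u : E → ℝ) (x : E) : ‖∇ u x‖ = ‖fderiv ℝ u x‖ := by
  rw [gradient, LinearIsometryEquiv.norm_map]

lemma gradient_eq_zero_of_notMem_tsupport {u : E → ℝ} {x : E} (hx : x ∉ tsupport u) :
    ∇ u x = 0 := by
  rw [gradient, image_eq_zero_of_notMem_tsupport fun h => hx (tsupport_fderiv_subset ℝ h),
    map_zero]

lemma divergence_sq_smul_le {u : E → ℝ} {F : E → E} {x : E} (hu : DifferentiableAt ℝ u x)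
    (hF : DifferentiableAt ℝ F x) :
    divergence (fun y => u y ^ 2 • F y) x
      ≤ ‖∇ u x‖ ^ 2 + (divergence F x + ‖F x‖ ^ 2) * u x ^ 2 := by
  have hsq := sq_nonneg ‖∇ u x - u x • F x‖
  rw [norm_sub_sq_real, inner_smul_right, inner_gradient_left, norm_smul, mul_pow,
    Real.norm_eq_abs, sq_abs] at hsq
  rw [divergence_smul (f := fun y => u y ^ 2) (hu.pow 2) hF, fderiv_fun_pow 2 hu]
  simp only [smul_apply, smul_eq_mul, Nat.add_one_sub_one, pow_one, nsmul_eq_mul, Nat.cast_ofNat]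
  linarith

variable [MeasurableSpace E] [BorelSpace E] {μ : Measure E}

lemma integrable_divergence [IsFiniteMeasureOnCompacts μ] {F : E → E} (hF : ContDiff ℝ 1 F)
    (hc : HasCompactSupport F) : Integrable (divergence F) μ := by
  simp only [funext (divergence_eq_sum_inner F)]
  exact integrable_finsetSum _ fun i _ => (integrable_fderiv_apply hF hc _).const_inner _

lemma integral_divergence_eq_zero [μ.IsAddHaarMeasure] {F : E → E} (hF : ContDiff ℝ 1 F)
    (hc : HasCompactSupport F) : ∫ x, divergence F x ∂μ = 0 := by
  let b := stdOrthonormalBasis ℝ E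
  have hI (i) : Integrable (fun x => fderiv ℝ F x (b i)) μ := integrable_fderiv_apply hF hc (b i)
  calc ∫ x, divergence F x ∂μ = ∑ i, ∫ x, ⟪b i, fderiv ℝ F x (b i)⟫ ∂μ := by
        simp only [divergence_eq_sum_inner]
        exact integral_finsetSum _ fun i _ => (hI i).const_inner (b i)
    _ = ∑ i, ⟪b i, ∫ x, fderiv ℝ F x (b i) ∂μ⟫ :=
        Finset.sum_congr rfl fun i _ => integral_inner (hI i) (b i)
    _ = 0 := by simp [integral_fderiv_apply_eq_zero hF hc]

lemma integrable_norm_gradient_sq [IsFiniteMeasureOnCompacts μ] {u : E → ℝ} (hu : ContDiff ℝ 1 u)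
    (hc : HasCompactSupport u) : Integrable (fun x => ‖∇ u x‖ ^ 2) μ := by
  simp_rw [norm_gradient]
  have hcont : Continuous fun x => ‖fderiv ℝ u x‖ ^ 2 :=
    (hu.continuous_fderiv one_ne_zero).norm.pow 2
  have hsupp : HasCompactSupport fun x => ‖fderiv ℝ u x‖ ^ 2 :=
    (hc.fderiv (𝕜 := ℝ)).comp_left (g := fun L : E →L[ℝ] ℝ => ‖L‖ ^ 2) (by simp)
  exact hcont.integrable_of_hasCompactSupport hsupp

lemma integral_mul_sq_le_integral_norm_gradient_sq [μ.IsAddHaarMeasure] {u V : E → ℝ} {F : E → E}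
    (hu : ContDiff ℝ 1 u) (hc : HasCompactSupport u) (hF : ∀ x ∈ tsupport u, ContDiffAt ℝ 1 F x)
    (hV : Integrable (fun x => V x * u x ^ 2) μ)
    (h : ∀ x ∈ tsupport u, divergence F x + ‖F x‖ ^ 2 ≤ -V x) :
    ∫ x, V x * u x ^ 2 ∂μ ≤ ∫ x, ‖∇ u x‖ ^ 2 ∂μ := by
  have hsupp : tsupport (fun x => u x ^ 2) ⊆ tsupport u :=
    closure_mono (Function.support_pow u two_ne_zero).subset
  have hG := contDiff_smul_of_tsupport (hu.pow 2) fun x hx => hF x (hsupp hx)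
  have hGc : HasCompactSupport (fun x => u x ^ 2 • F x) :=
    (hc.comp_left (g := fun t : ℝ => t ^ 2) (by simp)).smul_right
  have hI := integrable_norm_gradient_sq (μ := μ) hu hc
  calc ∫ x, V x * u x ^ 2 ∂μ
      ≤ ∫ x, (‖∇ u x‖ ^ 2 - divergence (fun y => u y ^ 2 • F y) x) ∂μ := by
        refine integral_mono hV (hI.sub (integrable_divergence hG hGc)) fun x => ?_
        by_cases hx : x ∈ tsupport u
        · have h1 := divergence_sq_smul_le (hu.differentiable one_ne_zero x)
            ((hF x hx).differentiableAt one_ne_zero)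
          have h2 := mul_le_mul_of_nonneg_right (h x hx) (sq_nonneg (u x))
          dsimp only
          linarith
        · have hG0 : fderiv ℝ (fun y => u y ^ 2 • F y) x = 0 :=
            image_eq_zero_of_notMem_tsupport fun h' =>
              hx (hsupp (tsupport_smul_subset_left _ _ (tsupport_fderiv_subset ℝ h')))
          simp [divergence, hG0, image_eq_zero_of_notMem_tsupport hx]
    _ = ∫ x, ‖∇ u x‖ ^ 2 ∂μ := by
        rw [integral_sub hI (integrable_divergence hG hGc), integral_divergence_eq_zero hG hGc,
          sub_zero]

end VectorFieldMethod

lemma fderiv_fun_inv_apply {E : Type*} [NormedAddCommGroup E] [NormedSpace ℝ E] {f : E → ℝ} {x : E}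
    (hf : DifferentiableAt ℝ f x) (h : f x ≠ 0) (v : E) :
    fderiv ℝ (fun y => (f y)⁻¹) x v = -fderiv ℝ f x v / f x ^ 2 := by
  have hd := (hasDerivAt_inv h).comp_hasFDerivAt x hf.hasFDerivAt
  rw [show (fun y => (f y)⁻¹) = Inv.inv ∘ f from rfl, hd.fderiv, smul_apply, smul_eq_mul]
  ring

section BipolarField

variable {E : Type*} [NormedAddCommGroup E] [InnerProductSpace ℝ E]

lemma norm_sq_eq_of_inner_sub (b x : E) :
    ‖b‖ ^ 2 = ‖x‖ ^ 2 + ‖x - b‖ ^ 2 - 2 * ⟪x, x - b⟫ := by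
  have h := norm_sub_sq_real x (x - b)
  rw [sub_sub_cancel] at h
  linarith

lemma fderiv_inv_inner_sub_apply {b x : E} (h : ⟪x, x - b⟫ ≠ 0) (v : E) :
    fderiv ℝ (fun y => ⟪y, y - b⟫⁻¹) x v = -(⟪x, v⟫ + ⟪v, x - b⟫) / ⟪x, x - b⟫ ^ 2 := by
  have hd : DifferentiableAt ℝ (fun y => y - b) x := by fun_prop
  rw [fderiv_fun_inv_apply (f := fun y => ⟪y, y - b⟫) (differentiableAt_fun_id.inner ℝ hd) h,
    fderiv_inner_apply ℝ differentiableAt_fun_id hd]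
  simp [fderiv_sub_const]

lemma fderiv_inv_norm_sub_sq_apply {a x : E} (h : x - a ≠ 0) (v : E) :
    fderiv ℝ (fun y => (‖y - a‖ ^ 2)⁻¹) x v = -(2 * ⟪x - a, v⟫) / (‖x - a‖ ^ 2) ^ 2 := by
  have hd : HasFDerivAt (fun y => ‖y - a‖ ^ 2) _ x :=
    ((hasFDerivAt_id (𝕜 := ℝ) x).sub_const a).norm_sq
  rw [fderiv_fun_inv_apply hd.differentiableAt (by simpa using h), hd.fderiv]
  simp [inner_sub_left]

lemma fderiv_inv_norm_self {x : E} (h : x ≠ 0) :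
    fderiv ℝ (fun y : E => ‖y‖⁻¹) x x = -‖x‖⁻¹ := by
  have hd : DifferentiableAt ℝ (fun y : E => ‖y‖) x :=
    (contDiffAt_norm ℝ h).differentiableAt one_ne_zero
  have hr : ‖x‖ ≠ 0 := norm_ne_zero_iff.2 h
  rw [fderiv_fun_inv_apply hd hr, hd.fderiv_norm_self]
  field_simp

/-- The part of `bipolarField b` that points away from the pole `a`. -/
noncomputable def bipolarSummand (b a x : E) : E :=
  (⟪x, x - b⟫⁻¹ - finrank ℝ E / 2 * (‖x - a‖ ^ 2)⁻¹) • (x - a)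

/-- The logarithmic gradient of `⟪x, x - b⟫ (‖x‖ ‖x - b‖) ^ (-N / 2)`, where `N = dim E`. This
function vanishes on the sphere with diameter `[0, b]` and is positive outside it. -/
noncomputable def bipolarField (b x : E) : E :=
  bipolarSummand b 0 x + bipolarSummand b b x

lemma ne_zero_and_sub_ne_zero_of_inner_pos {b x : E} (h : 0 < ⟪x, x - b⟫) :
    x ≠ 0 ∧ x - b ≠ 0 :=
  ⟨fun h0 => by simp [h0] at h, fun h0 => by simp [h0] at h⟩

lemma contDiffAt_bipolarSummand {b a x : E} (h : 0 < ⟪x, x - b⟫) (ha : x - a ≠ 0)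
    {k : WithTop ℕ∞} : ContDiffAt ℝ k (bipolarSummand b a) x := by
  have hw : ContDiffAt ℝ k (fun y : E => ⟪y, y - b⟫⁻¹) x :=
    (contDiffAt_id.inner ℝ (contDiffAt_id.sub contDiffAt_const)).inv h.ne'
  have hr : ContDiffAt ℝ k (fun y : E => (‖y - a‖ ^ 2)⁻¹) x :=
    ((contDiffAt_id.sub contDiffAt_const).norm_sq ℝ).inv (by simpa using ha)
  unfold bipolarSummand
  fun_prop

lemma contDiffAt_bipolarField {b x : E} (h : 0 < ⟪x, x - b⟫) {k : WithTop ℕ∞} :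
    ContDiffAt ℝ k (bipolarField b) x :=
  have ⟨hx, hz⟩ := ne_zero_and_sub_ne_zero_of_inner_pos h
  (contDiffAt_bipolarSummand h (by simpa using hx)).add (contDiffAt_bipolarSummand h hz)

lemma inner_bipolarField {b x : E} (h : 0 < ⟪x, x - b⟫) :
    ⟪bipolarField b x, x⟫ = ‖x‖ ^ 2 / ⟪x, x - b⟫ + 1
      - finrank ℝ E / 2 * (1 + ⟪x, x - b⟫ / ‖x - b‖ ^ 2) := by
  have hx := norm_ne_zero_iff.2 (ne_zero_and_sub_ne_zero_of_inner_pos h).1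
  simp only [bipolarField, bipolarSummand, sub_zero, inner_add_left, real_inner_smul_left,
    real_inner_self_eq_norm_sq, real_inner_comm x (x - b)]
  field_simp
  ring

variable [FiniteDimensional ℝ E]

lemma divergence_bipolarSummand {b a x : E} (h : ⟪x, x - b⟫ ≠ 0) (ha : x - a ≠ 0) :
    divergence (bipolarSummand b a) x
      = -(⟪x, x - a⟫ + ⟪x - a, x - b⟫) / ⟪x, x - b⟫ ^ 2 + finrank ℝ E / ‖x - a‖ ^ 2
        + finrank ℝ E * (⟪x, x - b⟫⁻¹ - finrank ℝ E / 2 * (‖x - a‖ ^ 2)⁻¹) := by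
  have hd : DifferentiableAt ℝ (fun y : E => y - b) x := by fun_prop
  have hw : DifferentiableAt ℝ (fun y => ⟪y, y - b⟫⁻¹) x :=
    (differentiableAt_fun_id.inner ℝ hd).inv h
  have hr : DifferentiableAt ℝ (fun y => (‖y - a‖ ^ 2)⁻¹) x :=
    (DifferentiableAt.norm_sq ℝ (by fun_prop)).inv (by simpa using ha)
  have hdiv : divergence (bipolarSummand b a) x = _ :=
    divergence_smul_sub (hw.fun_sub (hr.const_mul _)) a
  rw [hdiv, fderiv_fun_sub hw (hr.const_mul _), fderiv_const_mul hr, sub_apply, smul_apply,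
    fderiv_inv_inner_sub_apply h, fderiv_inv_norm_sub_sq_apply ha, real_inner_self_eq_norm_sq]
  have := norm_ne_zero_iff.2 ha
  simp only [smul_eq_mul]
  field_simp
  ring

lemma divergence_bipolarField_add_norm_sq {b x : E} (h : 0 < ⟪x, x - b⟫) :
    divergence (bipolarField b) x + ‖bipolarField b x‖ ^ 2
      = -((finrank ℝ E : ℝ) ^ 2 / 4 * ‖b‖ ^ 2 / (‖x‖ ^ 2 * ‖x - b‖ ^ 2)) := by
  have ⟨hx, hz⟩ := ne_zero_and_sub_ne_zero_of_inner_pos h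
  have hx' : x - 0 ≠ 0 := by simpa using hx
  have hdiff {a : E} (ha : x - a ≠ 0) : DifferentiableAt ℝ (bipolarSummand b a) x :=
    (contDiffAt_bipolarSummand h ha (k := 1)).differentiableAt one_ne_zero
  have hdiv : divergence (bipolarField b) x = _ := divergence_add (hdiff hx') (hdiff hz)
  rw [hdiv, divergence_bipolarSummand h.ne' hx', divergence_bipolarSummand h.ne' hz, bipolarField,
    bipolarSummand, bipolarSummand, norm_add_sq_real, norm_smul, norm_smul, real_inner_smul_left,
    real_inner_smul_right, norm_sq_eq_of_inner_sub b x, mul_pow, mul_pow, Real.norm_eq_abs,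
    Real.norm_eq_abs, sq_abs, sq_abs]
  simp only [sub_zero, real_inner_self_eq_norm_sq]
  have := norm_ne_zero_iff.2 hx
  have := norm_ne_zero_iff.2 hz
  field_simp
  ring

lemma divergence_sub_smul_add_norm_sq {F : E → E} {x : E} (hF : DifferentiableAt ℝ F x)
    (hx : x ≠ 0) (δ : ℝ) :
    divergence (fun y => F y - (δ * ‖y‖⁻¹) • y) x + ‖F x - (δ * ‖x‖⁻¹) • x‖ ^ 2
      = divergence F x + ‖F x‖ ^ 2
        + (δ ^ 2 - δ * (finrank ℝ E - 1) / ‖x‖ - 2 * δ * ⟪F x, x⟫ / ‖x‖) := by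
  have hr : ‖x‖ ≠ 0 := norm_ne_zero_iff.2 hx
  have hd : DifferentiableAt ℝ (fun y : E => ‖y‖⁻¹) x :=
    ((contDiffAt_norm ℝ hx).differentiableAt one_ne_zero).inv hr
  have hδ : DifferentiableAt ℝ (fun y : E => -(δ * ‖y‖⁻¹)) x := (hd.const_mul δ).fun_neg
  simp only [sub_eq_add_neg, ← neg_smul]
  rw [divergence_add hF (hδ.fun_smul differentiableAt_fun_id), divergence_smul_id hδ,
    fderiv_fun_neg, fderiv_const_mul hd, norm_add_sq_real, real_inner_smul_right, norm_smul,
    mul_pow, norm_neg, Real.norm_eq_abs, sq_abs]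
  simp only [neg_apply, smul_apply, fderiv_inv_norm_self hx, smul_eq_mul]
  field_simp
  ring

/-- The `bipolarField` of the ground state multiplied by `exp (-δ ‖x‖)`, where `δ = N ^ 2 / ‖b‖`. -/
noncomputable def dampedBipolarField (b x : E) : E :=
  bipolarField b x - (finrank ℝ E ^ 2 / ‖b‖ * ‖x‖⁻¹) • x

lemma divergence_dampedBipolarField_add_norm_sq {b x : E} (h : 0 < ⟪x, x - b⟫) {N δ : ℝ}
    (hN : N = finrank ℝ E) (hδ : δ = N ^ 2 / ‖b‖) :
    divergence (dampedBipolarField b) x + ‖dampedBipolarField b x‖ ^ 2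
      = -(N ^ 2 / 4 * ‖b‖ ^ 2 / (‖x‖ ^ 2 * ‖x - b‖ ^ 2))
        + (δ ^ 2 - δ / ‖x‖ - 2 * δ * ‖x‖ / ⟪x, x - b⟫
          + N * δ * ⟪x, x - b⟫ / (‖x‖ * ‖x - b‖ ^ 2)) := by
  have ⟨hx, hz⟩ := ne_zero_and_sub_ne_zero_of_inner_pos h
  have hF : DifferentiableAt ℝ (bipolarField b) x :=
    (contDiffAt_bipolarField h (k := 1)).differentiableAt one_ne_zero
  have key := divergence_sub_smul_add_norm_sq hF hx δ
  rw [divergence_bipolarField_add_norm_sq h, inner_bipolarField h, hδ, hN] at key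
  rw [hδ, hN]
  refine key.trans ?_
  have := norm_ne_zero_iff.2 hx
  have := norm_ne_zero_iff.2 hz
  field_simp
  ring

lemma one_sub_two_mul_div_le_sq_div_sq {r s d : ℝ} (hr : 0 ≤ r) (hrd : 2 * r ≤ d) (hd : 0 < d)
    (hs : 0 < s) (hsd : s ≤ d + r) : 1 - 2 * r / d ≤ d ^ 2 / s ^ 2 := by
  rw [one_sub_div hd.ne', div_le_div_iff₀ hd (by positivity)]
  calc (d - 2 * r) * s ^ 2 ≤ (d - 2 * r) * (d + r) ^ 2 := by
        gcongr
    _ = d ^ 2 * d - r ^ 2 * (3 * d + 2 * r) := by ring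
    _ ≤ d ^ 2 * d := sub_le_self _ (by positivity)

-- Here `r, s, d, w` stand for `‖x‖, ‖x - b‖, ‖b‖, ⟪x, x - b⟫`.
lemma damped_potential_le {N r s w d δ : ℝ} (hN : 1 ≤ N) (hr : 0 < r) (hd : 8 * N ^ 2 * r ≤ d)
    (hs₁ : d - r ≤ s) (hs₂ : s ≤ d + r) (hw : 0 < w) (hws : w ≤ r * s) (hδ : δ = N ^ 2 / d) :
    -(N ^ 2 / 4 * d ^ 2 / (r ^ 2 * s ^ 2))
        + (δ ^ 2 - δ / r - 2 * δ * r / w + N * δ * w / (r * s ^ 2)) ≤ -(N ^ 2 / 4 / r ^ 2) := by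
  have hN2 : N ≤ N ^ 2 := by nlinarith
  have hd0 : 0 < d := by nlinarith
  have hs4 : 4 * N * r ≤ s := by nlinarith
  have hs : 0 < s := by nlinarith
  have hδ0 : 0 < δ := by rw [hδ]; positivity
  have hmain : N ^ 2 / 4 / r ^ 2 - N ^ 2 / 4 * d ^ 2 / (r ^ 2 * s ^ 2) ≤ δ / (2 * r) := by
    have hratio : 1 - 2 * r / d ≤ d ^ 2 / s ^ 2 :=
      one_sub_two_mul_div_le_sq_div_sq hr.le (by nlinarith) hd0 hs hs₂
    calc N ^ 2 / 4 / r ^ 2 - N ^ 2 / 4 * d ^ 2 / (r ^ 2 * s ^ 2)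
        = N ^ 2 / (4 * r ^ 2) * (1 - d ^ 2 / s ^ 2) := by field_simp
      _ ≤ N ^ 2 / (4 * r ^ 2) * (2 * r / d) := by gcongr; linarith
      _ = δ / (2 * r) := by rw [hδ]; field_simp; norm_num
  have hsq : δ ^ 2 ≤ δ / (8 * r) := by
    rw [le_div_iff₀ (by positivity), sq, mul_assoc]
    refine mul_le_of_le_one_right hδ0.le ?_
    rw [hδ, div_mul_eq_mul_div, div_le_one hd0]
    linarith
  have hcross : N * δ * w / (r * s ^ 2) ≤ δ / (4 * r) := by
    rw [div_le_div_iff₀ (by positivity) (by positivity)]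
    calc N * δ * w * (4 * r) ≤ N * δ * (r * s) * (4 * r) := by gcongr
      _ = δ * r * s * (4 * N * r) := by ring
      _ ≤ δ * r * s * s := by gcongr
      _ = δ * (r * s ^ 2) := by ring
  have hneg : 0 ≤ 2 * δ * r / w := by positivity
  have hsum : δ / (2 * r) + δ / (8 * r) + δ / (4 * r) ≤ δ / r := by
    rw [show δ / (2 * r) + δ / (8 * r) + δ / (4 * r) = 7 / 8 * (δ / r) by field_simp; norm_num]
    have : 0 < δ / r := by positivity
    linarith
  linarith

lemma divergence_dampedBipolarField_add_norm_sq_le {b x : E} (h : 0 < ⟪x, x - b⟫)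
    (hb : 8 * (finrank ℝ E : ℝ) ^ 2 * ‖x‖ ≤ ‖b‖) :
    divergence (dampedBipolarField b) x + ‖dampedBipolarField b x‖ ^ 2
      ≤ -((finrank ℝ E : ℝ) ^ 2 / 4 / ‖x‖ ^ 2) := by
  have ⟨hx, _⟩ := ne_zero_and_sub_ne_zero_of_inner_pos h
  have hN : (1 : ℝ) ≤ finrank ℝ E := by
    exact_mod_cast finrank_pos_iff_exists_ne_zero.2 ⟨x, hx⟩
  rw [divergence_dampedBipolarField_add_norm_sq h rfl rfl]
  refine damped_potential_le hN (norm_pos_iff.2 hx) hb ?_ ?_ h (real_inner_le_norm _ _) rfl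
  · linarith [norm_sub_norm_le b x, norm_sub_rev b x]
  · linarith [norm_sub_le x b]

end BipolarField

section HardyLowerBound

variable {E : Type*} [NormedAddCommGroup E]

lemma integrable_sq_div_norm_sq [MeasurableSpace E] [BorelSpace E] {μ : Measure E}
    [IsFiniteMeasureOnCompacts μ] {u : E → ℝ} (hu : Continuous u) (hc : HasCompactSupport u)
    (h0 : 0 ∉ tsupport u) : Integrable (fun x => u x ^ 2 / ‖x‖ ^ 2) μ := by
  refine Continuous.integrable_of_hasCompactSupport (continuous_iff_continuousAt.2 fun x => ?_)
    (hc.mono fun x hx h => hx (by simp [h]))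
  by_cases hx : x ∈ tsupport u
  · have hx0 : x ≠ 0 := fun h => h0 (h ▸ hx)
    exact ContinuousAt.div (by fun_prop) (by fun_prop) (by simpa using hx0)
  · refine (continuousAt_const (y := (0 : ℝ))).congr ?_
    filter_upwards [notMem_tsupport_iff_eventuallyEq.1 hx] with y hy
    simp [hy]

variable [InnerProductSpace ℝ E]

lemma contDiffAt_dampedBipolarField {b x : E} (h : 0 < ⟪x, x - b⟫) {k : WithTop ℕ∞} :
    ContDiffAt ℝ k (dampedBipolarField b) x := by
  have hx := (ne_zero_and_sub_ne_zero_of_inner_pos h).1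
  exact (contDiffAt_bipolarField h).sub ((contDiffAt_const.mul
    ((contDiffAt_norm ℝ hx).inv (norm_ne_zero_iff.2 hx))).smul contDiffAt_id)

lemma inner_sub_pos_of_disjoint_ball {Ω : Set E} {p : E} (hΩ : IsOpen Ω) (hp : p ≠ 0)
    (hdisj : Disjoint (Metric.ball p ‖p‖) Ω) {x : E} (hx : x ∈ Ω) :
    0 < ⟪x, x - (2 : ℝ) • p⟫ := by
  have hfar : ‖p‖ < ‖x - p‖ := by
    have h := (hdisj.closure_left hΩ).notMem_of_mem_right hx
    rwa [closure_ball p (norm_ne_zero_iff.2 hp), Metric.mem_closedBall, dist_eq_norm,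
      not_le] at h
  have hexp := norm_sub_sq_real x p
  rw [inner_sub_right, real_inner_smul_right, real_inner_self_eq_norm_sq]
  nlinarith [norm_nonneg p]

variable [FiniteDimensional ℝ E] [MeasurableSpace E] [BorelSpace E] {μ : Measure E}
  [μ.IsAddHaarMeasure]

lemma hardy_inequality_of_inner_sub_pos {u : E → ℝ} {b : E} (hu : ContDiff ℝ 1 u)
    (hc : HasCompactSupport u) (hpos : ∀ x ∈ tsupport u, 0 < ⟪x, x - b⟫)
    (hsmall : ∀ x ∈ tsupport u, 8 * (finrank ℝ E : ℝ) ^ 2 * ‖x‖ ≤ ‖b‖) :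
    (finrank ℝ E : ℝ) ^ 2 / 4 * ∫ x, u x ^ 2 / ‖x‖ ^ 2 ∂μ ≤ ∫ x, ‖∇ u x‖ ^ 2 ∂μ := by
  have h0 : (0 : E) ∉ tsupport u := fun h => by simpa using hpos 0 h
  have hV (x : E) : (finrank ℝ E : ℝ) ^ 2 / 4 / ‖x‖ ^ 2 * u x ^ 2
      = (finrank ℝ E : ℝ) ^ 2 / 4 * (u x ^ 2 / ‖x‖ ^ 2) := by ring
  have key := integral_mul_sq_le_integral_norm_gradient_sq (μ := μ)
    (V := fun x => (finrank ℝ E : ℝ) ^ 2 / 4 / ‖x‖ ^ 2) hu hc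
    (fun x hx => contDiffAt_dampedBipolarField (hpos x hx))
    (by simpa only [hV] using (integrable_sq_div_norm_sq hu.continuous hc h0).const_mul _)
    (fun x hx => divergence_dampedBipolarField_add_norm_sq_le (hpos x hx) (hsmall x hx))
  simpa only [hV, integral_const_mul] using key

end HardyLowerBound

section Euclidean

variable {n : ℕ} {Ω : Set (EucSp n)} {c : ℝ}

lemma hardyInequality_iff : HardyInequality Ω c ↔ ∀ u : EucSp n → ℝ, IsTestFunction Ω u →
    c * ∫ x, u x ^ 2 / ‖x‖ ^ 2 ≤ ∫ x, ‖∇ u x‖ ^ 2 := by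
  refine forall₂_congr fun u hu => ?_
  rw [setIntegral_eq_integral_of_forall_compl_eq_zero fun x hx => ?_,
    setIntegral_eq_integral_of_forall_compl_eq_zero fun x hx => ?_]
  · simp [gradient_eq_zero_of_notMem_tsupport fun h => hx (hu.2.2 h)]
  · simp [image_eq_zero_of_notMem_tsupport fun h => hx (hu.2.2 h)]

lemma hardyInequality_of_disjoint_ball (hΩ : IsOpen Ω) {p : EucSp n} (hp : p ≠ 0)
    (hdisj : Disjoint (Metric.ball p ‖p‖) Ω) (hsmall : ∀ x ∈ Ω, 4 * n ^ 2 * ‖x‖ ≤ ‖p‖) :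
    HardyInequality Ω ((n : ℝ) ^ 2 / 4) := by
  refine hardyInequality_iff.2 fun u ⟨hu, hc, hsub⟩ => ?_
  simpa using hardy_inequality_of_inner_sub_pos (μ := volume) (b := (2 : ℝ) • p)
    (hu.of_le (by simp)) hc
    (fun x hx => inner_sub_pos_of_disjoint_ball hΩ hp hdisj (hsub hx))
    (fun x hx => by
      rw [finrank_euclideanSpace_fin, norm_smul, Real.norm_ofNat]
      linarith [hsmall x (hsub hx)])

end Euclidean

section HalfSpace

variable {E : Type*} [NormedAddCommGroup E] [InnerProductSpace ℝ E]

/-- The open half space with inner normal `ν`. -/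
def openHalfSpace (ν : E) : Set E := {x | 0 < ⟪ν, x⟫}

lemma isOpen_openHalfSpace (ν : E) : IsOpen (openHalfSpace ν) :=
  isOpen_lt continuous_const (continuous_const.inner continuous_id)

lemma smul_mem_ball_norm {y x : E} {t : ℝ} (ht : 0 < t) (h : t * ‖x‖ ^ 2 < 2 * ⟪y, x⟫) :
    t • x ∈ Metric.ball y ‖y‖ := by
  rw [Metric.mem_ball, dist_eq_norm]
  refine lt_of_pow_lt_pow_left₀ 2 (norm_nonneg y) ?_
  rw [norm_sub_sq_real, real_inner_smul_left, norm_smul, mul_pow, Real.norm_eq_abs, sq_abs,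
    real_inner_comm]
  nlinarith [mul_lt_mul_of_pos_left h ht]

lemma exists_pos_smul_mem_ball_norm {K : Set E} {y : E} (hK : IsCompact K)
    (hsub : K ⊆ openHalfSpace y) : ∃ t : ℝ, 0 < t ∧ ∀ x ∈ K, t • x ∈ Metric.ball y ‖y‖ := by
  obtain ⟨M, hM⟩ := hK.exists_bound_of_continuousOn (f := fun x => ‖x‖ ^ 2 / ⟪y, x⟫)
    ((continuous_norm.pow 2).continuousOn.div (continuous_const.inner continuous_id).continuousOn
      fun x hx => (hsub hx).ne')
  refine ⟨(|M| + 1)⁻¹, by positivity, fun x hx => smul_mem_ball_norm (by positivity) ?_⟩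
  have hpos : 0 < ⟪y, x⟫ := hsub hx
  have hle : ‖x‖ ^ 2 / ⟪y, x⟫ < |M| + 1 := by
    linarith [Real.le_norm_self (‖x‖ ^ 2 / ⟪y, x⟫), hM x hx, le_abs_self M]
  rw [div_lt_iff₀ hpos] at hle
  rw [inv_mul_lt_iff₀ (by positivity)]
  nlinarith [abs_nonneg M]

end HalfSpace

section Scaling

variable {n : ℕ} {Ω : Set (EucSp n)} {c : ℝ}

lemma IsTestFunction.comp_smul {u : EucSp n → ℝ} {s : ℝ} (hu : IsTestFunction Ω u) (hs : s ≠ 0) :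
    IsTestFunction ((s • ·) ⁻¹' Ω) fun x => u (s • x) := by
  refine ⟨hu.1.comp (contDiff_const_smul s),
    hu.2.1.comp_homeomorph (Homeomorph.smulOfNeZero s hs), ?_⟩
  rw [show tsupport (fun x => u (s • x)) = (s • ·) ⁻¹' tsupport u from
    tsupport_comp_eq_preimage u (Homeomorph.smulOfNeZero s hs)]
  exact preimage_mono hu.2.2

lemma integral_sq_div_norm_sq_comp_smul (u : EucSp n → ℝ) {s : ℝ} (hs : s ≠ 0) :
    ∫ x, u (s • x) ^ 2 / ‖x‖ ^ 2 = s ^ 2 * |(s ^ n)⁻¹| * ∫ x, u x ^ 2 / ‖x‖ ^ 2 := by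
  have hpot (x : EucSp n) : u (s • x) ^ 2 / ‖x‖ ^ 2 = s ^ 2 * (u (s • x) ^ 2 / ‖s • x‖ ^ 2) := by
    rw [norm_smul, mul_pow, Real.norm_eq_abs, sq_abs, mul_div_assoc',
      mul_div_mul_left _ _ (pow_ne_zero 2 hs)]
  simp_rw [hpot]
  rw [integral_const_mul, Measure.integral_comp_smul volume (fun x => u x ^ 2 / ‖x‖ ^ 2),
    finrank_euclideanSpace_fin, smul_eq_mul, mul_assoc]

lemma integral_norm_gradient_sq_comp_smul (u : EucSp n → ℝ) (s : ℝ) :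
    ∫ x, ‖∇ (fun y => u (s • y)) x‖ ^ 2 = s ^ 2 * |(s ^ n)⁻¹| * ∫ x, ‖∇ u x‖ ^ 2 := by
  have hgrad (x : EucSp n) : ‖∇ (fun y => u (s • y)) x‖ ^ 2 = s ^ 2 * ‖∇ u (s • x)‖ ^ 2 := by
    rw [norm_gradient, norm_gradient, fderiv_comp_smul, norm_smul, mul_pow, Real.norm_eq_abs,
      sq_abs]
  simp_rw [hgrad]
  rw [integral_const_mul, Measure.integral_comp_smul volume (fun x => ‖∇ u x‖ ^ 2),
    finrank_euclideanSpace_fin, smul_eq_mul, mul_assoc]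

lemma HardyInequality.preimage_smul (hH : HardyInequality Ω c) {t : ℝ} (ht : t ≠ 0) :
    HardyInequality ((t • ·) ⁻¹' Ω) c := by
  rw [hardyInequality_iff] at hH ⊢
  intro u hu
  have hpre : (t⁻¹ • · : EucSp n → EucSp n) ⁻¹' ((t • ·) ⁻¹' Ω) = Ω := by
    ext x
    simp [smul_smul, ht]
  have h := hH _ (hpre ▸ hu.comp_smul (inv_ne_zero ht))
  rw [integral_sq_div_norm_sq_comp_smul u (inv_ne_zero ht), integral_norm_gradient_sq_comp_smul,
    mul_left_comm] at h
  exact le_of_mul_le_mul_left h (by positivity)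

lemma HardyInequality.openHalfSpace_of_ball_subset (hH : HardyInequality Ω c) {y : EucSp n}
    (hball : Metric.ball y ‖y‖ ⊆ Ω) : HardyInequality (openHalfSpace y) c := by
  rw [hardyInequality_iff]
  intro u hu
  obtain ⟨t, ht, hmem⟩ := exists_pos_smul_mem_ball_norm hu.2.1.isCompact hu.2.2
  exact hardyInequality_iff.1 (hH.preimage_smul ht.ne') u
    ⟨hu.1, hu.2.1, fun x hx => hball (hmem x hx)⟩

end Scaling

section SmoothPos

/-- A smooth approximation of the positive part of `t`, exact where `s * t ∉ (1, 2)`. -/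
noncomputable def smoothPos (s t : ℝ) : ℝ := t * Real.smoothTransition (s * t - 1)

lemma contDiff_smoothPos (s : ℝ) : ContDiff ℝ ∞ (smoothPos s) :=
  contDiff_id.mul (Real.smoothTransition.contDiff.comp
    ((contDiff_const.mul contDiff_id).sub contDiff_const))

lemma smoothPos_of_mul_le_one {s t : ℝ} (h : s * t ≤ 1) : smoothPos s t = 0 := by
  rw [smoothPos, Real.smoothTransition.zero_of_nonpos (by linarith), mul_zero]

lemma smoothPos_of_two_le_mul {s t : ℝ} (h : 2 ≤ s * t) : smoothPos s t = t := by
  rw [smoothPos, Real.smoothTransition.one_of_one_le (by linarith), mul_one]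

lemma abs_smoothPos_le (s t : ℝ) : |smoothPos s t| ≤ |t| := by
  rw [smoothPos, abs_mul, abs_of_nonneg (Real.smoothTransition.nonneg _)]
  exact mul_le_of_le_one_right (abs_nonneg t) (Real.smoothTransition.le_one _)

lemma deriv_smoothPos_of_two_lt_mul {s t : ℝ} (h : 2 < s * t) : deriv (smoothPos s) t = 1 := by
  have heq : smoothPos s =ᶠ[𝓝 t] id := by
    filter_upwards [(continuous_const_mul s).continuousAt.eventually_const_lt h] with z hz
      using smoothPos_of_two_le_mul hz.le
  rw [heq.deriv_eq, deriv_id]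

lemma deriv_smoothPos_of_mul_lt_one {s t : ℝ} (h : s * t < 1) : deriv (smoothPos s) t = 0 := by
  have heq : smoothPos s =ᶠ[𝓝 t] fun _ => 0 := by
    filter_upwards [(continuous_const_mul s).continuousAt.eventually_lt_const h] with z hz
      using smoothPos_of_mul_le_one hz.le
  rw [heq.deriv_eq, deriv_const]

lemma deriv_smoothPos_eq_deriv_smoothPos_one {s : ℝ} (hs : s ≠ 0) (t : ℝ) :
    deriv (smoothPos s) t = deriv (smoothPos 1) (s * t) := by
  have hscale : smoothPos s = fun t => s⁻¹ * smoothPos 1 (s * t) := by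
    ext t
    simp only [smoothPos, one_mul]
    field_simp
  rw [hscale, deriv_const_mul_field, deriv_comp_mul_left s (smoothPos 1), smul_eq_mul,
    inv_mul_cancel_left₀ hs]

lemma exists_abs_deriv_smoothPos_le :
    ∃ C, ∀ s t : ℝ, s ≠ 0 → |deriv (smoothPos s) t| ≤ C := by
  obtain ⟨C, hC⟩ := isCompact_Icc.exists_bound_of_continuousOn (s := Icc (1 : ℝ) 2)
    ((contDiff_smoothPos 1).continuous_deriv (by simp)).continuousOn
  refine ⟨max C 1, fun s t hs => ?_⟩
  rw [deriv_smoothPos_eq_deriv_smoothPos_one hs]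
  rcases lt_or_ge (s * t) 1 with h1 | h1
  · simp [deriv_smoothPos_of_mul_lt_one (s := 1) (t := s * t) (by linarith)]
  rcases lt_or_ge 2 (s * t) with h2 | h2
  · simp [deriv_smoothPos_of_two_lt_mul (s := 1) (t := s * t) (by linarith)]
  · exact (hC _ ⟨h1, h2⟩).trans (le_max_left _ _)

end SmoothPos

section InnerMul

variable {E : Type*} [NormedAddCommGroup E] [InnerProductSpace ℝ E] {ν : E} {h : E → ℝ}

lemma fderiv_comp_inner_mul {g : ℝ → ℝ} {d : ℝ} {x : E} (hg : HasDerivAt g d ⟪ν, x⟫)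
    (hh : DifferentiableAt ℝ h x) :
    fderiv ℝ (fun x => g ⟪ν, x⟫ * h x) x
      = g ⟪ν, x⟫ • fderiv ℝ h x + h x • (d • innerSL ℝ ν) := by
  have hcomp : HasFDerivAt (fun x => g ⟪ν, x⟫) (d • innerSL ℝ ν) x :=
    hg.comp_hasFDerivAt (h₂ := g) x (innerSL ℝ ν).hasFDerivAt
  exact (hcomp.mul hh.hasFDerivAt).fderiv

lemma fderiv_inner_mul {x : E} (hh : DifferentiableAt ℝ h x) :
    fderiv ℝ (fun x => ⟪ν, x⟫ * h x) x = ⟪ν, x⟫ • fderiv ℝ h x + h x • innerSL ℝ ν := by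
  simpa using fderiv_comp_inner_mul (hasDerivAt_id ⟪ν, x⟫) hh

lemma fderiv_smoothPos_inner_mul (s : ℝ) {x : E} (hh : DifferentiableAt ℝ h x) :
    fderiv ℝ (fun x => smoothPos s ⟪ν, x⟫ * h x) x
      = smoothPos s ⟪ν, x⟫ • fderiv ℝ h x + h x • (deriv (smoothPos s) ⟪ν, x⟫ • innerSL ℝ ν) :=
  fderiv_comp_inner_mul ((contDiff_smoothPos s).differentiable (by simp) _).hasDerivAt hh

lemma contDiff_smoothPos_inner_mul (hh : ContDiff ℝ ∞ h) (s : ℝ) :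
    ContDiff ℝ ∞ fun x => smoothPos s ⟪ν, x⟫ * h x :=
  ((contDiff_smoothPos s).comp (contDiff_const.inner ℝ contDiff_id)).mul hh

lemma isTestFunction_smoothPos_inner_mul {n : ℕ} {ν : EucSp n} {h : EucSp n → ℝ}
    (hh : ContDiff ℝ ∞ h) (hc : HasCompactSupport h) {s : ℝ} (hs : 0 < s) :
    IsTestFunction (openHalfSpace ν) fun x => smoothPos s ⟪ν, x⟫ * h x := by
  refine ⟨contDiff_smoothPos_inner_mul hh s, hc.mul_left, ?_⟩
  have hclosed : IsClosed {x : EucSp n | 1 ≤ s * ⟪ν, x⟫} :=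
    isClosed_le continuous_const (by fun_prop)
  refine (closure_minimal (fun x hx => ?_) hclosed).trans fun x hx => ?_
  · by_contra hlt
    exact hx (by simp only [smoothPos_of_mul_le_one (not_le.1 hlt).le, zero_mul])
  · exact pos_of_mul_pos_right (one_pos.trans_le hx) hs.le

variable [FiniteDimensional ℝ E] [MeasurableSpace E] [BorelSpace E]
  {μ : Measure E} [IsFiniteMeasureOnCompacts μ]

lemma tendsto_integral_smoothPos_inner_mul_sq_div (hh : Continuous h) (hc : HasCompactSupport h)
    (h0 : 0 ∉ tsupport h) :
    Tendsto (fun s => ∫ x in openHalfSpace ν, (smoothPos s ⟪ν, x⟫ * h x) ^ 2 / ‖x‖ ^ 2 ∂μ) atTop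
      (𝓝 (∫ x in openHalfSpace ν, (⟪ν, x⟫ * h x) ^ 2 / ‖x‖ ^ 2 ∂μ)) := by
  refine tendsto_integral_filter_of_dominated_convergence
    (fun x => (⟪ν, x⟫ * h x) ^ 2 / ‖x‖ ^ 2) (Eventually.of_forall fun s => ?_)
    (Eventually.of_forall fun s => Eventually.of_forall fun x => ?_) ?_ ?_
  · have := (contDiff_smoothPos s).continuous
    exact Measurable.aestronglyMeasurable (by fun_prop)
  · rw [Real.norm_of_nonneg (by positivity)]
    gcongr ?_ / _
    rw [sq_le_sq, abs_mul, abs_mul]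
    exact mul_le_mul_of_nonneg_right (abs_smoothPos_le _ _) (abs_nonneg _)
  · exact (integrable_sq_div_norm_sq (by fun_prop) hc.mul_left
      fun hmem => h0 (tsupport_mul_subset_right hmem)).integrableOn
  · filter_upwards [ae_restrict_mem (isOpen_openHalfSpace ν).measurableSet] with x hx
    refine tendsto_const_nhds.congr' ?_
    filter_upwards [(tendsto_id.atTop_mul_const hx).eventually_ge_atTop 2]
      with s (hs : 2 ≤ s * ⟪ν, x⟫)
    rw [smoothPos_of_two_le_mul hs]

lemma tendsto_integral_norm_gradient_smoothPos_inner_mul_sq (hh : ContDiff ℝ ∞ h)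
    (hc : HasCompactSupport h) :
    Tendsto (fun s => ∫ x in openHalfSpace ν, ‖∇ (fun x => smoothPos s ⟪ν, x⟫ * h x) x‖ ^ 2 ∂μ)
      atTop (𝓝 (∫ x in openHalfSpace ν, ‖∇ (fun x => ⟪ν, x⟫ * h x) x‖ ^ 2 ∂μ)) := by
  obtain ⟨C, hC⟩ := exists_abs_deriv_smoothPos_le
  have hdiff : Differentiable ℝ h := hh.differentiable (by simp)
  have hdh : Continuous (fderiv ℝ h) := hh.continuous_fderiv (by simp)
  refine tendsto_integral_filter_of_dominated_convergence
    (fun x => (|⟪ν, x⟫| * ‖fderiv ℝ h x‖ + |h x| * (C * ‖ν‖)) ^ 2)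
    (Eventually.of_forall fun s => ?_) ?_ ?_ ?_
  · exact (integrable_norm_gradient_sq ((contDiff_smoothPos_inner_mul hh s).of_le
      (by exact_mod_cast le_top)) hc.mul_left).aestronglyMeasurable.restrict
  · filter_upwards [eventually_ne_atTop 0] with s hs
    refine Eventually.of_forall fun x => ?_
    rw [Real.norm_of_nonneg (by positivity), norm_gradient, fderiv_smoothPos_inner_mul s (hdiff x)]
    gcongr
    refine (norm_add_le _ _).trans ?_
    rw [norm_smul, norm_smul, norm_smul, innerSL_apply_norm, Real.norm_eq_abs, Real.norm_eq_abs,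
      Real.norm_eq_abs]
    gcongr ?_ * _ + _ * (?_ * _)
    exacts [abs_smoothPos_le _ _, hC _ _ hs]
  · have hcd : HasCompactSupport fun x => |⟪ν, x⟫| * ‖fderiv ℝ h x‖ + |h x| * (C * ‖ν‖) :=
      (hc.fderiv (𝕜 := ℝ)).norm.mul_left.add hc.norm.mul_right
    have := hh.continuous
    refine (Continuous.integrable_of_hasCompactSupport (by fun_prop) ?_).integrableOn
    exact hcd.comp_left (g := fun t : ℝ => t ^ 2) (by simp)
  · filter_upwards [ae_restrict_mem (isOpen_openHalfSpace ν).measurableSet] with x hx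
    refine tendsto_const_nhds.congr' ?_
    filter_upwards [(tendsto_id.atTop_mul_const hx).eventually_gt_atTop 2]
      with s (hs : 2 < s * ⟪ν, x⟫)
    rw [norm_gradient, norm_gradient, fderiv_smoothPos_inner_mul s (hdiff x),
      fderiv_inner_mul (hdiff x), smoothPos_of_two_le_mul hs.le,
      deriv_smoothPos_of_two_lt_mul hs, one_smul]

lemma HardyInequality.mul_integral_inner_mul_sq_le {n : ℕ} {c : ℝ} {ν : EucSp n}
    {h : EucSp n → ℝ} (hH : HardyInequality (openHalfSpace ν) c) (hh : ContDiff ℝ ∞ h)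
    (hc : HasCompactSupport h) (h0 : 0 ∉ tsupport h) :
    c * ∫ x in openHalfSpace ν, (⟪ν, x⟫ * h x) ^ 2 / ‖x‖ ^ 2
      ≤ ∫ x in openHalfSpace ν, ‖∇ (fun x => ⟪ν, x⟫ * h x) x‖ ^ 2 :=
  le_of_tendsto_of_tendsto
    ((tendsto_integral_smoothPos_inner_mul_sq_div hh.continuous hc h0).const_mul c)
    (tendsto_integral_norm_gradient_smoothPos_inner_mul_sq hh hc) <|
    (eventually_gt_atTop 0).mono fun _ hs => hH _ (isTestFunction_smoothPos_inner_mul hh hc hs)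

end InnerMul

section Symmetry

variable {E : Type*} [NormedAddCommGroup E] [InnerProductSpace ℝ E]

lemma inner_reflection_sub {ν e : E} (h : ‖ν‖ = ‖e‖) (x : E) :
    ⟪e, (ℝ ∙ (ν - e))ᗮ.reflection x⟫ = ⟪ν, x⟫ := by
  nth_rw 1 [← Submodule.reflection_sub h]
  rw [LinearIsometryEquiv.inner_map_map]

lemma inner_sq_mul_comp_norm_comp_reflection {ν e : E} (h : ‖ν‖ = ‖e‖) (f : ℝ → ℝ) :
    (fun x => ⟪e, x⟫ ^ 2 * f ‖x‖) ∘ (ℝ ∙ (ν - e))ᗮ.reflection = fun x => ⟪ν, x⟫ ^ 2 * f ‖x‖ := by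
  ext x
  simp only [Function.comp_apply, inner_reflection_sub h, LinearIsometryEquiv.norm_map]

variable [FiniteDimensional ℝ E] [MeasurableSpace E] [BorelSpace E]

lemma compl_openHalfSpace_ae_eq {μ : Measure E} [μ.IsAddHaarMeasure] {ν : E} (hν : ν ≠ 0) :
    ((openHalfSpace ν)ᶜ : Set E) =ᵐ[μ] Neg.neg ⁻¹' openHalfSpace ν := by
  have hnull : μ (LinearMap.ker (innerSL ℝ ν).toLinearMap) = 0 := by
    refine Measure.addHaar_submodule _ _ fun htop => hν ?_
    have hmem : ν ∈ LinearMap.ker (innerSL ℝ ν).toLinearMap := htop ▸ Submodule.mem_top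
    simpa using hmem
  filter_upwards [measure_eq_zero_iff_ae_notMem.1 hnull] with x (hx : ⟪ν, x⟫ ≠ 0)
  have hiff : ¬ 0 < ⟪ν, x⟫ ↔ 0 < ⟪ν, -x⟫ := by
    rw [inner_neg_right, neg_pos, not_lt, hx.le_iff_lt]
  exact propext hiff

lemma integral_eq_two_mul_setIntegral_openHalfSpace {μ : Measure E} [μ.IsAddHaarMeasure] {ν : E}
    (hν : ν ≠ 0) {f : E → ℝ} (hf : Integrable f μ) (heven : ∀ x, f (-x) = f x) :
    ∫ x, f x ∂μ = 2 * ∫ x in openHalfSpace ν, f x ∂μ := by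
  have hreflect : ∫ x in Neg.neg ⁻¹' openHalfSpace ν, f x ∂μ = ∫ x in openHalfSpace ν, f x ∂μ := by
    simpa only [heven] using (Measure.measurePreserving_neg μ).setIntegral_preimage_emb
      (MeasurableEquiv.neg E).measurableEmbedding f (openHalfSpace ν)
  rw [← integral_add_compl (isOpen_openHalfSpace ν).measurableSet hf,
    setIntegral_congr_set (compl_openHalfSpace_ae_eq hν), hreflect, two_mul]

lemma integrable_inner_sq_mul_div_norm_sq {μ : Measure E} {f : E → ℝ} (hf : Integrable f μ) {ν : E}
    (hν : ‖ν‖ = 1) : Integrable (fun x => ⟪ν, x⟫ ^ 2 * (f x / ‖x‖ ^ 2)) μ := by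
  refine hf.mono (((by fun_prop : Measurable fun x => ⟪ν, x⟫ ^ 2).aestronglyMeasurable).mul
    (hf.aestronglyMeasurable.div₀ (by fun_prop))) (Eventually.of_forall fun x => ?_)
  have hle : ⟪ν, x⟫ ^ 2 ≤ ‖x‖ ^ 2 := by
    simpa [hν] using sq_le_sq' (neg_le_of_abs_le (abs_real_inner_le_norm ν x))
      (real_inner_le_norm ν x)
  rw [mul_div_left_comm, norm_mul, Real.norm_of_nonneg (by positivity : 0 ≤ ⟪ν, x⟫ ^ 2 / ‖x‖ ^ 2)]
  exact mul_le_of_le_one_right (norm_nonneg _) (div_le_one_of_le₀ hle (sq_nonneg _))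

lemma integral_inner_sq_mul_comp_norm {ν e : E} (h : ‖ν‖ = ‖e‖) (f : ℝ → ℝ) :
    ∫ x, ⟪ν, x⟫ ^ 2 * f ‖x‖ = ∫ x, ⟪e, x⟫ ^ 2 * f ‖x‖ := by
  rw [← inner_sq_mul_comp_norm_comp_reflection h]
  let T : E ≃ₗᵢ[ℝ] E := (ℝ ∙ (ν - e))ᗮ.reflection
  exact T.measurePreserving.integral_comp T.toHomeomorph.measurableEmbedding
    fun x => ⟪e, x⟫ ^ 2 * f ‖x‖

lemma integral_comp_norm_eq_finrank_mul {ν : E} (hν : ‖ν‖ = 1) {f : ℝ → ℝ}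
    (hf : Integrable fun x : E => f ‖x‖) (h0 : f 0 = 0) :
    ∫ x : E, f ‖x‖ = finrank ℝ E * ∫ x, ⟪ν, x⟫ ^ 2 * (f ‖x‖ / ‖x‖ ^ 2) := by
  let b := stdOrthonormalBasis ℝ E
  have hsum (x : E) : f ‖x‖ = ∑ i, ⟪b i, x⟫ ^ 2 * (f ‖x‖ / ‖x‖ ^ 2) := by
    rw [← Finset.sum_mul, b.sum_sq_inner_right, mul_div_cancel_of_imp']
    intro h
    rw [pow_eq_zero_iff two_ne_zero] at h
    rw [h, h0]
  have hb (i) : ∫ x, ⟪b i, x⟫ ^ 2 * (f ‖x‖ / ‖x‖ ^ 2) = ∫ x, ⟪ν, x⟫ ^ 2 * (f ‖x‖ / ‖x‖ ^ 2) :=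
    integral_inner_sq_mul_comp_norm (by rw [hν, b.norm_eq_one]) fun r => f r / r ^ 2
  calc ∫ x : E, f ‖x‖ = ∫ x, ∑ i, ⟪b i, x⟫ ^ 2 * (f ‖x‖ / ‖x‖ ^ 2) :=
        integral_congr_ae (.of_forall hsum)
    _ = ∑ i, ∫ x, ⟪b i, x⟫ ^ 2 * (f ‖x‖ / ‖x‖ ^ 2) := integral_finsetSum _ fun i _ =>
        integrable_inner_sq_mul_div_norm_sq hf (b.norm_eq_one i)
    _ = finrank ℝ E * ∫ x, ⟪ν, x⟫ ^ 2 * (f ‖x‖ / ‖x‖ ^ 2) := by simp [hb]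

end Symmetry

section LogRadial

/-- The radial function equal to `ψ (log ‖x‖)`, so that the dilations of `E` act on it by
translations of `ψ`. With `ψ` supported in `(0, ∞)` it vanishes on the unit ball, and
`Real.log 0 = 0` is harmless. -/
noncomputable def logRadial {E : Type*} [Norm E] (ψ : ℝ → ℝ) (x : E) : ℝ := ψ (Real.log ‖x‖)

variable {E : Type*} [NormedAddCommGroup E] {ψ : ℝ → ℝ}

lemma logRadial_eq_zero_of_norm_le_one (hψ : tsupport ψ ⊆ Ioi 0) {x : E} (hx : ‖x‖ ≤ 1) :
    logRadial ψ x = 0 :=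
  image_eq_zero_of_notMem_tsupport (f := ψ) fun h =>
    (Real.log_nonpos (norm_nonneg x) hx).not_gt (hψ h)

lemma zero_notMem_tsupport_logRadial (hψ : tsupport ψ ⊆ Ioi 0) :
    (0 : E) ∉ tsupport (logRadial ψ : E → ℝ) := by
  rw [notMem_tsupport_iff_eventuallyEq]
  filter_upwards [Metric.ball_mem_nhds (0 : E) one_pos] with x hx
  exact logRadial_eq_zero_of_norm_le_one hψ (mem_ball_zero_iff.1 hx).le

lemma hasCompactSupport_logRadial [ProperSpace E] (hψ : tsupport ψ ⊆ Ioi 0)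
    (hc : HasCompactSupport ψ) : HasCompactSupport (logRadial ψ : E → ℝ) := by
  obtain ⟨M, hM⟩ := hc.isCompact.bddAbove
  refine .intro (isCompact_closedBall 0 (Real.exp M)) fun x hx =>
    image_eq_zero_of_notMem_tsupport (f := ψ) fun h => hx ?_
  have hx0 : 0 < ‖x‖ := (norm_nonneg x).lt_of_ne' fun h0 => by
    simpa [h0] using hψ h
  rw [mem_closedBall_zero_iff, ← Real.log_le_iff_le_exp hx0]
  exact hM h

lemma contDiff_logRadial [InnerProductSpace ℝ E] (hψ : tsupport ψ ⊆ Ioi 0) {k : WithTop ℕ∞}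
    (hs : ContDiff ℝ k ψ) : ContDiff ℝ k (logRadial ψ : E → ℝ) := by
  refine contDiff_iff_contDiffAt.2 fun x => ?_
  rcases eq_or_ne x 0 with rfl | hx
  · exact contDiffAt_const.congr_of_eventuallyEq
      (notMem_tsupport_iff_eventuallyEq.1 (zero_notMem_tsupport_logRadial hψ))
  · exact hs.contDiffAt.comp x ((contDiffAt_norm ℝ hx).log (norm_ne_zero_iff.2 hx))

lemma hasFDerivAt_log_norm [InnerProductSpace ℝ E] {x : E} (hx : x ≠ 0) :
    HasFDerivAt (fun x => Real.log ‖x‖) ((‖x‖ ^ 2)⁻¹ • innerSL ℝ x) x := by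
  have hlog : (fun x : E => Real.log ‖x‖) = fun x => (1 / 2) * Real.log (‖x‖ ^ 2) := by
    ext x
    rw [Real.log_pow]
    push_cast
    ring
  rw [hlog]
  refine (((hasStrictFDerivAt_norm_sq x).hasFDerivAt.log
    (pow_ne_zero 2 (norm_ne_zero_iff.2 hx))).const_mul (1 / 2)).congr_fderiv ?_
  ext v
  simp only [one_div, smul_apply, coe_innerSL_apply, nsmul_eq_mul, Nat.cast_ofNat, smul_eq_mul]
  ring

lemma fderiv_logRadial [InnerProductSpace ℝ E] (hψ : tsupport ψ ⊆ Ioi 0)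
    (hd : Differentiable ℝ ψ) (x : E) :
    fderiv ℝ (logRadial ψ) x = (logRadial (deriv ψ) x / ‖x‖ ^ 2) • innerSL ℝ x := by
  rcases eq_or_ne x 0 with rfl | hx
  · rw [image_eq_zero_of_notMem_tsupport fun h =>
      zero_notMem_tsupport_logRadial hψ (tsupport_fderiv_subset ℝ h), map_zero, smul_zero]
  · have hcomp : HasFDerivAt (logRadial ψ) _ x :=
      (hd _).hasDerivAt.comp_hasFDerivAt (h₂ := ψ) x (hasFDerivAt_log_norm hx)
    rw [hcomp.fderiv, smul_smul, logRadial, div_eq_mul_inv]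

lemma norm_gradient_inner_mul_logRadial_sq [InnerProductSpace ℝ E] [FiniteDimensional ℝ E]
    (hψ : tsupport ψ ⊆ Ioi 0) (hs : ContDiff ℝ 1 ψ) {ν : E} (hν : ‖ν‖ = 1) (x : E) :
    ‖∇ (fun x => ⟪ν, x⟫ * logRadial ψ x) x‖ ^ 2 = logRadial ψ x ^ 2 + ⟪ν, x⟫ ^ 2 *
      ((2 * (logRadial ψ x * logRadial (deriv ψ) x) + logRadial (deriv ψ) x ^ 2) / ‖x‖ ^ 2) := by
  have hfderiv : fderiv ℝ (fun x => ⟪ν, x⟫ * logRadial ψ x) x = innerSL ℝ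
      ((⟪ν, x⟫ * (logRadial (deriv ψ) x / ‖x‖ ^ 2)) • x + logRadial ψ x • ν) := by
    rw [fderiv_inner_mul ((contDiff_logRadial hψ hs).differentiable one_ne_zero x),
      fderiv_logRadial hψ (hs.differentiable one_ne_zero), map_add, map_smul, map_smul, smul_smul]
  rw [norm_gradient, hfderiv, innerSL_apply_norm, norm_add_sq_real, norm_smul, norm_smul,
    real_inner_smul_left, real_inner_smul_right, hν, real_inner_comm, mul_pow, Real.norm_eq_abs,
    Real.norm_eq_abs, mul_one, sq_abs, sq_abs]
  rcases eq_or_ne x 0 with rfl | hx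
  · simp
  · field_simp
    ring

end LogRadial

section RadialTestFunctions

variable {E : Type*} [NormedAddCommGroup E] [InnerProductSpace ℝ E] [FiniteDimensional ℝ E]
  [MeasurableSpace E] [BorelSpace E] {ψ : ℝ → ℝ}

lemma integrable_logRadial_mul {μ : Measure E} [IsFiniteMeasureOnCompacts μ] {φ χ : ℝ → ℝ}
    (hsupp : tsupport φ ⊆ Ioi 0) (hc : HasCompactSupport φ) (hφ : Continuous φ)
    (hχ : Continuous χ) : Integrable (fun x => logRadial φ x * logRadial χ x) μ := by
  have hsupp' : tsupport (fun t => φ t * χ t) ⊆ Ioi 0 := tsupport_mul_subset_left.trans hsupp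
  exact (contDiff_logRadial hsupp' (contDiff_zero.2 (hφ.mul hχ))).continuous
    |>.integrable_of_hasCompactSupport (hasCompactSupport_logRadial hsupp' hc.mul_right)

lemma integral_logRadial_mul_logRadial_deriv {μ : Measure E} [μ.IsAddHaarMeasure]
    (hψ : tsupport ψ ⊆ Ioi 0) (hc : HasCompactSupport ψ) (hs : ContDiff ℝ 1 ψ) :
    2 * ∫ x, logRadial ψ x * logRadial (deriv ψ) x ∂μ
      = -(finrank ℝ E * ∫ x, logRadial ψ x * logRadial ψ x ∂μ) := by
  have hh : ContDiff ℝ 1 (logRadial ψ : E → ℝ) := contDiff_logRadial hψ hs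
  have hdiv (x : E) : divergence (fun x => logRadial ψ x ^ 2 • x) x
      = 2 * (logRadial ψ x * logRadial (deriv ψ) x)
        + finrank ℝ E * (logRadial ψ x * logRadial ψ x) := by
    have hd : DifferentiableAt ℝ (logRadial ψ) x := hh.differentiable one_ne_zero x
    refine (divergence_smul_id (hd.fun_pow 2)).trans ?_
    rw [fderiv_fun_pow 2 hd, fderiv_logRadial hψ (hs.differentiable one_ne_zero)]
    rcases eq_or_ne x 0 with rfl | hx
    · simp [logRadial_eq_zero_of_norm_le_one hψ]
    · simp only [Nat.add_one_sub_one, pow_one, nsmul_eq_mul, Nat.cast_ofNat, smul_apply,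
        coe_innerSL_apply, real_inner_self_eq_norm_sq, smul_eq_mul]
      field_simp
  have hzero : ∫ x, divergence (fun x => logRadial ψ x ^ 2 • x) x ∂μ = 0 :=
    integral_divergence_eq_zero ((hh.pow 2).smul contDiff_id)
      ((hasCompactSupport_logRadial hψ hc).comp_left (g := fun t : ℝ => t ^ 2) (by simp)).smul_right
  have hI {χ : ℝ → ℝ} (hχ : Continuous χ) :
      Integrable (fun x => logRadial ψ x * logRadial χ x) μ :=
    integrable_logRadial_mul hψ hc hs.continuous hχ
  simp_rw [hdiv] at hzero
  rw [integral_add ((hI (hs.continuous_deriv le_rfl)).const_mul _) ((hI hs.continuous).const_mul _),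
    integral_const_mul, integral_const_mul] at hzero
  linarith

lemma integral_inner_mul_logRadial_sq_div_norm_sq (hψ : tsupport ψ ⊆ Ioi 0)
    (hc : HasCompactSupport ψ) (hs : Continuous ψ) {ν : E} (hν : ‖ν‖ = 1) :
    finrank ℝ E * ∫ x, (⟪ν, x⟫ * logRadial ψ x) ^ 2 / ‖x‖ ^ 2
      = ∫ x : E, logRadial ψ x * logRadial ψ x := by
  have h0 : ψ 0 = 0 := image_eq_zero_of_notMem_tsupport fun h => self_notMem_Ioi (hψ h)
  simp_rw [mul_pow, mul_div_assoc, sq (logRadial ψ _)]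
  exact (integral_comp_norm_eq_finrank_mul hν (f := fun r => ψ (Real.log r) * ψ (Real.log r))
    (integrable_logRadial_mul hψ hc hs hs) (by simp [h0])).symm

lemma integral_norm_gradient_inner_mul_logRadial_sq (hψ : tsupport ψ ⊆ Ioi 0)
    (hc : HasCompactSupport ψ) (hs : ContDiff ℝ 1 ψ) {ν : E} (hν : ‖ν‖ = 1) :
    finrank ℝ E * ∫ x, ‖∇ (fun x => ⟪ν, x⟫ * logRadial ψ x) x‖ ^ 2
      = ∫ x : E, logRadial (deriv ψ) x * logRadial (deriv ψ) x := by
  have hψ' : tsupport (deriv ψ) ⊆ Ioi 0 := tsupport_deriv_subset.trans hψ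
  have hs' : Continuous (deriv ψ) := hs.continuous_deriv le_rfl
  let f (r : ℝ) := 2 * (ψ (Real.log r) * deriv ψ (Real.log r))
    + deriv ψ (Real.log r) * deriv ψ (Real.log r)
  have h0 : f 0 = 0 := by
    have h1 : ψ 0 = 0 := image_eq_zero_of_notMem_tsupport fun h => self_notMem_Ioi (hψ h)
    have h2 : deriv ψ 0 = 0 := image_eq_zero_of_notMem_tsupport fun h => self_notMem_Ioi (hψ' h)
    simp [f, h1, h2]
  have hI₀ : Integrable fun x : E => logRadial ψ x * logRadial ψ x :=
    integrable_logRadial_mul hψ hc hs.continuous hs.continuous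
  have hI₁ : Integrable fun x : E => 2 * (logRadial ψ x * logRadial (deriv ψ) x) :=
    (integrable_logRadial_mul hψ hc hs.continuous hs').const_mul 2
  have hI₂ : Integrable fun x : E => logRadial (deriv ψ) x * logRadial (deriv ψ) x :=
    integrable_logRadial_mul hψ' hc.deriv hs' hs'
  have hf : Integrable fun x : E => f ‖x‖ := hI₁.add hI₂
  calc finrank ℝ E * ∫ x, ‖∇ (fun x => ⟪ν, x⟫ * logRadial ψ x) x‖ ^ 2
      = finrank ℝ E * ∫ x : E, (logRadial ψ x * logRadial ψ x
          + ⟪ν, x⟫ ^ 2 * (f ‖x‖ / ‖x‖ ^ 2)) := by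
        simp only [norm_gradient_inner_mul_logRadial_sq hψ hs hν, sq (logRadial _ _)]
        rfl
    _ = finrank ℝ E * (∫ x : E, logRadial ψ x * logRadial ψ x) + ∫ x : E, f ‖x‖ := by
        rw [integral_add hI₀ (integrable_inner_sq_mul_div_norm_sq hf hν), mul_add,
          ← integral_comp_norm_eq_finrank_mul hν hf h0]
    _ = finrank ℝ E * (∫ x : E, logRadial ψ x * logRadial ψ x)
          + (2 * (∫ x : E, logRadial ψ x * logRadial (deriv ψ) x)
            + ∫ x : E, logRadial (deriv ψ) x * logRadial (deriv ψ) x) := by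
        rw [← integral_const_mul 2, ← integral_add hI₁ hI₂]
        rfl
    _ = ∫ x : E, logRadial (deriv ψ) x * logRadial (deriv ψ) x := by
        rw [integral_logRadial_mul_logRadial_deriv hψ hc hs]
        ring

end RadialTestFunctions

section Sharpness

variable {n : ℕ} {c : ℝ}

lemma HardyInequality.mul_integral_logRadial_sq_le {ν : EucSp n} (hν : ‖ν‖ = 1)
    (hH : HardyInequality (openHalfSpace ν) c) {ψ : ℝ → ℝ} (hψ : tsupport ψ ⊆ Ioi 0)
    (hc : HasCompactSupport ψ) (hs : ContDiff ℝ ∞ ψ) :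
    c * ∫ x : EucSp n, logRadial ψ x * logRadial ψ x
      ≤ ∫ x : EucSp n, logRadial (deriv ψ) x * logRadial (deriv ψ) x := by
  let u (x : EucSp n) : ℝ := ⟪ν, x⟫ * logRadial ψ x
  have hν0 : ν ≠ 0 := norm_ne_zero_iff.1 (hν ▸ one_ne_zero)
  have hs₁ : ContDiff ℝ 1 ψ := hs.of_le (by simp)
  have hh : ContDiff ℝ ∞ (logRadial ψ : EucSp n → ℝ) := contDiff_logRadial hψ hs
  have hhc : HasCompactSupport (logRadial ψ : EucSp n → ℝ) := hasCompactSupport_logRadial hψ hc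
  have hu : ContDiff ℝ 1 u := (contDiff_const.inner ℝ contDiff_id).mul (hh.of_le (by simp))
  have huc : HasCompactSupport u := hhc.mul_left
  have hu0 : (0 : EucSp n) ∉ tsupport u := fun h =>
    zero_notMem_tsupport_logRadial hψ (tsupport_mul_subset_right h)
  have hhalf : c * ∫ x in openHalfSpace ν, u x ^ 2 / ‖x‖ ^ 2
      ≤ ∫ x in openHalfSpace ν, ‖∇ u x‖ ^ 2 :=
    hH.mul_integral_inner_mul_sq_le hh hhc (zero_notMem_tsupport_logRadial hψ)
  have heven (x : EucSp n) : ‖∇ u (-x)‖ ^ 2 = ‖∇ u x‖ ^ 2 := by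
    simp only [u, norm_gradient_inner_mul_logRadial_sq hψ hs₁ hν]
    simp [logRadial]
  have hfull : c * ∫ x, u x ^ 2 / ‖x‖ ^ 2 ≤ ∫ x, ‖∇ u x‖ ^ 2 := by
    rw [integral_eq_two_mul_setIntegral_openHalfSpace hν0
        (integrable_sq_div_norm_sq hu.continuous huc hu0) fun x => by simp [u, logRadial],
      integral_eq_two_mul_setIntegral_openHalfSpace hν0 (integrable_norm_gradient_sq hu huc)
        heven]
    linarith
  rw [← integral_inner_mul_logRadial_sq_div_norm_sq hψ hc hs.continuous hν,
    ← integral_norm_gradient_inner_mul_logRadial_sq hψ hc hs₁ hν, mul_left_comm]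
  exact mul_le_mul_of_nonneg_left hfull (Nat.cast_nonneg _)

lemma integral_Ioi_zero_eq_integral_exp (f : ℝ → ℝ) :
    ∫ r in Ioi 0, f r = ∫ t, Real.exp t * f (Real.exp t) := by
  simpa [Real.range_exp, abs_of_pos (Real.exp_pos _)] using
    integral_image_eq_integral_abs_deriv_smul MeasurableSet.univ
      (fun t _ => (Real.hasDerivAt_exp t).hasDerivWithinAt) Real.exp_injective.injOn f

lemma integral_logRadial {E : Type*} [NormedAddCommGroup E] [NormedSpace ℝ E] [Nontrivial E]
    [FiniteDimensional ℝ E] [MeasurableSpace E] [BorelSpace E] (μ : Measure E)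
    [μ.IsAddHaarMeasure] (g : ℝ → ℝ) :
    ∫ x, logRadial g x ∂μ = finrank ℝ E * μ.real (Metric.ball 0 1) *
      ∫ t, Real.exp (finrank ℝ E * t) * g t := by
  have hpow (t : ℝ) : Real.exp t * (Real.exp t ^ (finrank ℝ E - 1) * g t)
      = Real.exp (finrank ℝ E * t) * g t := by
    rw [← mul_assoc, mul_pow_sub_one finrank_pos.ne', ← Real.exp_nat_mul]
  simp only [logRadial, integral_fun_norm_addHaar μ fun r => g (Real.log r), nsmul_eq_mul,
    smul_eq_mul, integral_Ioi_zero_eq_integral_exp, Real.log_exp, hpow, mul_assoc]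

lemma HardyInequality.mul_integral_exp_mul_sq_le {ν : EucSp n} (hν : ‖ν‖ = 1)
    (hH : HardyInequality (openHalfSpace ν) c) {ψ : ℝ → ℝ} (hψ : tsupport ψ ⊆ Ioi 0)
    (hc : HasCompactSupport ψ) (hs : ContDiff ℝ ∞ ψ) :
    c * ∫ t, Real.exp (n * t) * ψ t ^ 2 ≤ ∫ t, Real.exp (n * t) * deriv ψ t ^ 2 := by
  have : Nontrivial (EucSp n) := nontrivial_of_ne ν 0 (norm_ne_zero_iff.1 (hν ▸ one_ne_zero))
  have hpolar (χ : ℝ → ℝ) : ∫ x : EucSp n, logRadial χ x * logRadial χ x =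
      n * volume.real (Metric.ball (0 : EucSp n) 1) * ∫ t, Real.exp (n * t) * χ t ^ 2 := by
    simpa [logRadial, sq] using integral_logRadial (volume : Measure (EucSp n)) fun t => χ t * χ t
  have hle := hH.mul_integral_logRadial_sq_le hν hψ hc hs
  rw [hpolar, hpolar, mul_left_comm] at hle
  refine le_of_mul_le_mul_left hle (mul_pos ?_ ?_)
  · simpa using finrank_pos (R := ℝ) (M := EucSp n)
  · exact ENNReal.toReal_pos (Metric.measure_ball_pos _ _ one_pos).ne' measure_ball_lt_top.ne

end Sharpness

section OneDimensional

variable {a c : ℝ}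

lemma integral_mul_deriv_self {φ : ℝ → ℝ} (hφ : ContDiff ℝ 1 φ) (hc : HasCompactSupport φ) :
    ∫ t, φ t * deriv φ t = 0 := by
  have hd (t : ℝ) : HasDerivAt φ (deriv φ t) t := (hφ.differentiable one_ne_zero t).hasDerivAt
  have hprod : Integrable fun t => φ t * deriv φ t :=
    (hφ.continuous.mul (hφ.continuous_deriv le_rfl)).integrable_of_hasCompactSupport hc.mul_right
  have hparts := integral_mul_deriv_eq_deriv_mul_of_integrable (fun t _ => hd t) (fun t _ => hd t)
    hprod (by rw [mul_comm]; exact hprod)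
    ((hφ.continuous.mul hφ.continuous).integrable_of_hasCompactSupport hc.mul_right)
  simp only [mul_comm (deriv φ _)] at hparts
  linarith

lemma exp_mul_sq_exp_neg_half_mul (a t : ℝ) :
    Real.exp (a * t) * Real.exp (-(a / 2) * t) ^ 2 = 1 := by
  rw [← Real.exp_nat_mul, ← Real.exp_add, Real.exp_eq_one_iff]
  push_cast
  ring

lemma exp_mul_sq_deriv_exp_mul {φ : ℝ → ℝ} {t : ℝ} (hφ : DifferentiableAt ℝ φ t) :
    Real.exp (a * t) * deriv (fun t => Real.exp (-(a / 2) * t) * φ t) t ^ 2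
      = deriv φ t ^ 2 - a * (φ t * deriv φ t) + a ^ 2 / 4 * φ t ^ 2 := by
  have hE : HasDerivAt (fun t => Real.exp (-(a / 2) * t))
      (Real.exp (-(a / 2) * t) * (-(a / 2) * 1)) t :=
    ((hasDerivAt_id t).const_mul _).exp
  rw [(hE.fun_mul hφ.hasDerivAt).deriv]
  linear_combination (deriv φ t - a / 2 * φ t) ^ 2 *
    exp_mul_sq_exp_neg_half_mul a t

lemma integrable_sq_of_hasCompactSupport {φ : ℝ → ℝ} (hφ : Continuous φ)
    (hc : HasCompactSupport φ) : Integrable fun t => φ t ^ 2 :=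
  (hφ.pow 2).integrable_of_hasCompactSupport <| hc.mono (Function.support_pow φ two_ne_zero).subset

lemma integral_exp_mul_sq_deriv_exp_mul (a : ℝ) {φ : ℝ → ℝ} (hφ : ContDiff ℝ 1 φ)
    (hc : HasCompactSupport φ) :
    ∫ t, Real.exp (a * t) * deriv (fun t => Real.exp (-(a / 2) * t) * φ t) t ^ 2
      = (∫ t, deriv φ t ^ 2) + a ^ 2 / 4 * ∫ t, φ t ^ 2 := by
  have hc₁ : Continuous (deriv φ) := hφ.continuous_deriv le_rfl
  have hI₀ : Integrable fun t => φ t ^ 2 := integrable_sq_of_hasCompactSupport hφ.continuous hc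
  have hI₁ : Integrable fun t => a * (φ t * deriv φ t) :=
    ((hφ.continuous.mul hc₁).integrable_of_hasCompactSupport hc.mul_right).const_mul a
  have hI₂ : Integrable fun t => deriv φ t ^ 2 := integrable_sq_of_hasCompactSupport hc₁ hc.deriv
  have hI : Integrable fun t => deriv φ t ^ 2 - a * (φ t * deriv φ t) := hI₂.sub hI₁
  simp only [exp_mul_sq_deriv_exp_mul (hφ.differentiable one_ne_zero _)]
  rw [integral_add hI (hI₀.const_mul _), integral_sub hI₂ hI₁, integral_const_mul,
    integral_const_mul, integral_mul_deriv_self hφ hc, mul_zero, sub_zero]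

lemma mul_integral_sq_le_of_exp_weight
    (h : ∀ ψ : ℝ → ℝ, tsupport ψ ⊆ Ioi 0 → HasCompactSupport ψ → ContDiff ℝ ∞ ψ →
      c * ∫ t, Real.exp (a * t) * ψ t ^ 2 ≤ ∫ t, Real.exp (a * t) * deriv ψ t ^ 2)
    {φ : ℝ → ℝ} (hφ : tsupport φ ⊆ Ioi 0) (hc : HasCompactSupport φ) (hs : ContDiff ℝ ∞ φ) :
    (c - a ^ 2 / 4) * ∫ t, φ t ^ 2 ≤ ∫ t, deriv φ t ^ 2 := by
  have hle := h (fun t => Real.exp (-(a / 2) * t) * φ t)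
    (tsupport_mul_subset_right.trans hφ) hc.mul_left
    ((Real.contDiff_exp.comp (contDiff_const.mul contDiff_id)).mul hs)
  have hweight (t : ℝ) : Real.exp (a * t) * (Real.exp (-(a / 2) * t) * φ t) ^ 2 = φ t ^ 2 := by
    rw [mul_pow, ← mul_assoc, exp_mul_sq_exp_neg_half_mul, one_mul]
  simp only [hweight, integral_exp_mul_sq_deriv_exp_mul a (hs.of_le (by simp)) hc] at hle
  linarith

lemma nonpos_of_mul_integral_sq_le_integral_deriv_sq
    (h : ∀ φ : ℝ → ℝ, tsupport φ ⊆ Ioi 0 → HasCompactSupport φ → ContDiff ℝ ∞ φ →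
      c * ∫ t, φ t ^ 2 ≤ ∫ t, deriv φ t ^ 2) : c ≤ 0 := by
  let θ : ContDiffBump (2 : ℝ) := ⟨1 / 2, 1, by norm_num, by norm_num⟩
  have hθ : tsupport θ ⊆ Ioi 0 := by
    rw [θ.tsupport_eq, Real.closedBall_eq_Icc]
    exact fun t ht => lt_of_lt_of_le (by norm_num [θ]) ht.1
  have hscale {q : ℝ} (hq : 0 < q) : c * ∫ t, θ t ^ 2 ≤ q ^ 2 * ∫ t, deriv θ t ^ 2 := by
    have hsupp : tsupport (fun t => θ (q * t)) ⊆ Ioi 0 := by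
      refine (tsupport_comp_subset_preimage θ (continuous_const_mul q)).trans fun t ht => ?_
      exact pos_of_mul_pos_right (hθ ht) hq.le
    have hle := h (fun t => θ (q * t)) hsupp
      (θ.hasCompactSupport.comp_homeomorph (Homeomorph.mulLeft₀ q hq.ne'))
      (θ.contDiff.comp (contDiff_const.mul contDiff_id))
    simp only [deriv_comp_mul_left, smul_eq_mul, mul_pow, integral_const_mul] at hle
    rw [Measure.integral_comp_mul_left (fun t => θ t ^ 2),
      Measure.integral_comp_mul_left (fun t => deriv θ t ^ 2), smul_eq_mul, smul_eq_mul,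
      abs_of_pos (inv_pos.2 hq), mul_left_comm, mul_left_comm (q ^ 2)] at hle
    exact le_of_mul_le_mul_left hle (inv_pos.2 hq)
  have hlim : Tendsto (fun q : ℝ => q ^ 2 * ∫ t, deriv θ t ^ 2) (𝓝[>] 0) (𝓝 0) := by
    have hcont : Continuous fun q : ℝ => q ^ 2 * ∫ t, deriv θ t ^ 2 := by fun_prop
    simpa using (hcont.tendsto 0).mono_left nhdsWithin_le_nhds
  have hpos : 0 < ∫ t, θ t ^ 2 := by
    refine (θ.continuous.pow 2).integral_pos_of_hasCompactSupport_nonneg_nonzero (x := 2)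
      (θ.hasCompactSupport.comp_left (g := (· ^ 2)) (by simp)) (fun t => sq_nonneg _) ?_
    simp [θ.one_of_mem_closedBall (Metric.mem_closedBall_self θ.rIn_pos.le)]
  exact nonpos_of_mul_nonpos_left (ge_of_tendsto hlim
    (eventually_mem_nhdsWithin.mono fun q hq => hscale hq)) hpos

end OneDimensional

section MainTheorem

variable {n : ℕ} {Ω : Set (EucSp n)} {c : ℝ}

lemma openHalfSpace_smul {E : Type*} [NormedAddCommGroup E] [InnerProductSpace ℝ E] {r : ℝ}
    (hr : 0 < r) (ν : E) : openHalfSpace (r • ν) = openHalfSpace ν := by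
  ext x
  simp only [openHalfSpace, mem_ofPred_eq, real_inner_smul_left, mul_pos_iff_of_pos_left hr]

lemma HardyInequality.le_of_openHalfSpace {ν : EucSp n} (hν : ν ≠ 0)
    (hH : HardyInequality (openHalfSpace ν) c) : c ≤ n ^ 2 / 4 := by
  rw [← openHalfSpace_smul (inv_pos.2 (norm_pos_iff.2 hν))] at hH
  exact sub_nonpos.1 <| nonpos_of_mul_integral_sq_le_integral_deriv_sq fun φ =>
    mul_integral_sq_le_of_exp_weight fun ψ =>
      hH.mul_integral_exp_mul_sq_le (norm_smul_inv_norm (𝕜 := ℝ) hν)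

lemma HardyInequality.le_of_hasInteriorBall (hH : HardyInequality Ω c)
    (hball : HasInteriorBall Ω) : c ≤ n ^ 2 / 4 := by
  obtain ⟨y, r, hr, rfl, hy⟩ := hball
  exact (hH.openHalfSpace_of_ball_subset hy).le_of_openHalfSpace (norm_pos_iff.1 hr)

theorem theorem1p1_general (hΩ : IsOpen Ω) {p : EucSp n} (hp : p ≠ 0)
    (hext : Disjoint (Metric.ball p ‖p‖) Ω) (hsmall : ∀ x ∈ Ω, 4 * n ^ 2 * ‖x‖ ≤ ‖p‖) :
    HardyInequality Ω (n ^ 2 / 4) ∧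
      (HasInteriorBall Ω → IsGreatest {c : ℝ | HardyInequality Ω c} (n ^ 2 / 4)) :=
  have hHardy := hardyInequality_of_disjoint_ball hΩ hp hext hsmall
  ⟨hHardy, fun hball => ⟨hHardy, fun _ hc => hc.le_of_hasInteriorBall hball⟩⟩

lemma norm_le_maxNorm (hΩ : Bornology.IsBounded Ω) {x : EucSp n} (hx : x ∈ Ω) :
    ‖x‖ ≤ maxNorm Ω := by
  obtain ⟨M, hM⟩ := hΩ.exists_norm_le
  exact le_csSup ⟨M, forall_mem_image.2 hM⟩ (mem_image_of_mem _ hx)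

lemma HasExteriorBall.exists_center {hn : 2 ≤ n} {ρ : ℝ} (h : HasExteriorBall hn Ω ρ) :
    ∃ p : EucSp n, ‖p‖ = ρ ∧ Disjoint (Metric.ball p ‖p‖) Ω := by
  have hnorm : ‖-(ρ • lastUnit n hn)‖ = ρ := by
    rw [norm_neg, norm_smul, lastUnit, PiLp.norm_single, norm_one, mul_one,
      Real.norm_of_nonneg h.1.le]
  refine ⟨_, hnorm, ?_⟩
  rw [hnorm]
  exact disjoint_left.2 fun x hx hxΩ => h.2 hx (subset_closure hxΩ)

end MainTheorem

theorem theorem1p1 (n : ℕ) (hn : 2 ≤ n) :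
    ∃ τ : ℝ, 0 < τ ∧
      ∀ (Ω : Set (EucSp n)) (ρ : ℝ), IsBoundedDomain Ω → (0 : EucSp n) ∈ frontier Ω →
        HasExteriorBall hn Ω ρ → maxNorm Ω / τ ≤ ρ →
          HardyInequality Ω ((n : ℝ) ^ 2 / 4) ∧
          (HasInteriorBall Ω →
            IsGreatest {c : ℝ | HardyInequality Ω c} ((n : ℝ) ^ 2 / 4)) := by
  refine ⟨(4 * (n : ℝ) ^ 2)⁻¹, by positivity, fun Ω ρ hΩ _ hext hρ => ?_⟩
  obtain ⟨p, rfl, hdisj⟩ := hext.exists_center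
  rw [div_inv_eq_mul, mul_comm] at hρ
  exact theorem1p1_general hΩ.1 (norm_pos_iff.1 hext.1) hdisj fun x hx =>
    (mul_le_mul_of_nonneg_left (norm_le_maxNorm hΩ.2.2 hx) (by positivity)).trans hρ
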